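/- Consider, for functions $P(\rho,\theta)$, $E(\rho,\theta)$ of $\rho\in\mathbb R$ and $\theta\ge 0$, the Cauchy problem for the one-dimensional relativistic cold plasma equations with collision coefficient $\nu$, $$P_\theta+V P_\rho+E+\nu P=0,\qquad E_\theta+V E_\rho-V=0,\qquad V=\frac{P}{\sqrt{1+P^2}},\qquad P(\rho,0)=P_0(\rho),\quad E(\rho,0)=E_0(\rho).$$ Let $P_0,E_0\in C^2(\mathbb R)$ be bounded, and suppose that $P_0'$ is bounded below on $\mathbb R$ and that the initial electron density $N_0=1-E_0'$ is positive everywhere. (The data need not avoid simple waves, i.e. solutions with $E$ a function of $P$.) Then there exists $\nu>0$, depending on the data, such that the problem has a solution $(P,E)$ of class $C^2$ on $\mathbb R\times[0,\infty)$. Every solution of class $C^1$ on a strip $\mathbb R\times[0,T)$, $T>0$, coincides with $(P,E)$ there. Moreover $(P,E)$ stabilizes to the trivial stationary state as $\theta\to\infty$: $P\to0$ and $E\to0$ uniformly on $\mathbb R$, and $P_\rho\to0$ and $E_\rho\to0$ (so that the electron density $1-E_\rho\to1$) locally uniformly on $\mathbb R$. -/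

import Mathlib

open Set Filter Topology

namespace ColdPlasma

/-- The electron velocity `V = P / √(1 + P²)` belonging to the dimensionless momentum `P`. -/
noncomputable def velocity (p : ℝ) : ℝ := p / Real.sqrt (1 + p ^ 2)

/-- The dimensionless electron density `N = 1 - ∂E/∂ρ` belonging to a field profile `E`. -/
noncomputable def density (E : ℝ → ℝ) (ρ : ℝ) : ℝ := 1 - deriv E ρ

/-- `(P, E)`, functions of position `ρ` and time `θ`, is a classical solution of class `C^k` on
the time interval `I` (used for `I = [0, T)` and `I = [0, ∞)`) of the Cauchy problem

`P_θ + V P_ρ + E + ν P = 0`, `E_θ + V E_ρ - V = 0`, `V = P / √(1 + P²)`,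
`P(ρ, 0) = P₀(ρ)`, `E(ρ, 0) = E₀(ρ)`.

The functions are `C^k` jointly in `(ρ, θ)` up to the initial line; for `k ≥ 1` the partial
derivatives in the equations are therefore genuine. -/
structure IsClassicalSolution (k : WithTop ℕ∞) (ν : ℝ) (P₀ E₀ : ℝ → ℝ) (I : Set ℝ)
    (P E : ℝ → ℝ → ℝ) : Prop where
  contDiffOn_P : ContDiffOn ℝ k (fun z : ℝ × ℝ => P z.1 z.2) (univ ×ˢ I)
  contDiffOn_E : ContDiffOn ℝ k (fun z : ℝ × ℝ => E z.1 z.2) (univ ×ˢ I)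
  initial_P : ∀ ρ, P ρ 0 = P₀ ρ
  initial_E : ∀ ρ, E ρ 0 = E₀ ρ
  momentum_eq : ∀ ρ, ∀ θ ∈ interior I,
    deriv (fun t => P ρ t) θ + velocity (P ρ θ) * deriv (fun r => P r θ) ρ
      + E ρ θ + ν * P ρ θ = 0
  field_eq : ∀ ρ, ∀ θ ∈ interior I,
    deriv (fun t => E ρ t) θ + velocity (P ρ θ) * deriv (fun r => E r θ) ρ
      - velocity (P ρ θ) = 0

/-- Stabilization to the trivial stationary state `P = 0`, `E = 0` (density `1`) as `θ → ∞`: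
`P` and `E` tend to zero uniformly on the line, and the derivatives `Q = ∂P/∂ρ`, `D = ∂E/∂ρ`
tend to zero locally uniformly on the line. -/
structure Stabilizes (P E : ℝ → ℝ → ℝ) : Prop where
  tendsto_P : TendstoUniformly (fun θ ρ => P ρ θ) (fun _ => 0) atTop
  tendsto_E : TendstoUniformly (fun θ ρ => E ρ θ) (fun _ => 0) atTop
  tendsto_Q : TendstoLocallyUniformly (fun θ ρ => deriv (fun r => P r θ) ρ) (fun _ => 0) atTop
  tendsto_D : TendstoLocallyUniformly (fun θ ρ => deriv (fun r => E r θ) ρ) (fun _ => 0) atTop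

end ColdPlasma

/-! Along characteristics ρ' = V the system becomes the autonomous ODE p' = -e - νp, e' = V(p),
whose field is smooth and globally Lipschitz. Since e and the position have the same derivative V,
the characteristic from s is exactly s - E₀(s) + e(s, θ), and its Jacobian in s is N₀(s) + ∂ₛe. A
smooth global solution exists once this Jacobian stays positive and the position map is onto.

The s-derivatives q = ∂ₛp, w = ∂ₛe satisfy q' = -w - νq, w' = kq with k = V'(p) ∈ (0, 1]. If -m ≤
P₀', m ≥ 1 and ν ≥ m + 1, the bound q ≥ -m(N₀ + w) persists as long as the Jacobian is positive, so
the Jacobian is at least exp(-mθ) and never vanishes (`add_pos_of_damped`). Initially N₀ + w = 1 at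
every s, which is why one ν serves the whole line although N₀ need not be bounded away from zero.

Decay comes from one Lyapunov function for systems q' = -w - νq, w' = kq with c ≤ k ≤ 1
(`sq_add_sq_le_of_damped`). It applies to (q, w), and also to (p, e) itself because V(p) = (1 +
p²)^(-1/2) p. Boundedness of e makes the position map onto, and the inverse function theorem makes
its inverse C² (`contDiffOn_inverse_family`). Uniqueness is a Grönwall estimate along the
characteristics of the constructed solution (`eq_of_isClassicalSolution`).

The C² dependence of the flow on initial data and time is obtained from the implicit function
theorem applied to the Picard equation in C([0, 1], Y), with time as a parameter (`contDiff_path`).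
-/

namespace ColdPlasma

/-! ### Smoothness of superposition operators on spaces of continuous maps. -/

section Superposition

variable {K E F : Type} [TopologicalSpace K] [CompactSpace K]
  [NormedAddCommGroup E] [NormedSpace ℝ E] [NormedAddCommGroup F] [NormedSpace ℝ F]

/-- Pointwise application of a continuous family of operators, as a bounded bilinear map. -/
noncomputable def pointwiseApply (K E F : Type) [TopologicalSpace K] [CompactSpace K]
    [NormedAddCommGroup E] [NormedSpace ℝ E] [NormedAddCommGroup F] [NormedSpace ℝ F] :
    C(K, E →L[ℝ] F) →L[ℝ] C(K, E) →L[ℝ] C(K, F) :=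
  LinearMap.mkContinuous₂
    (LinearMap.mk₂ ℝ
      (fun (A : C(K, E →L[ℝ] F)) (h : C(K, E)) => (⟨fun t => A t (h t), by fun_prop⟩ : C(K, F)))
      (fun A B h => by ext; simp) (fun c A h => by ext; simp)
      (fun A h k => by ext; simp) (fun c A h => by ext; simp)) 1
    (fun A h => by
      rw [ContinuousMap.norm_le _ (by positivity)]
      intro t
      rw [one_mul]
      refine ((A t).le_opNorm _).trans ?_
      have hA := A.norm_coe_le_norm t
      have hh := h.norm_coe_le_norm t
      gcongr)

@[simp]
theorem pointwiseApply_apply (A : C(K, E →L[ℝ] F)) (h : C(K, E)) (t : K) :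
    pointwiseApply K E F A h t = A t (h t) := rfl

/-- The mean value inequality on each segment from γ t to η t gives the remainder estimate. It is
uniform in t because γ ↦ f' ∘ γ is continuous in the sup norm. -/
theorem hasFDerivAt_postcomp {f : E → F} {f' : E → E →L[ℝ] F} (hf : ∀ x, HasFDerivAt f (f' x) x)
    (hc : Continuous f) (hc' : Continuous f') (γ : C(K, E)) :
    HasFDerivAt (fun γ : C(K, E) => (⟨f, hc⟩ : C(E, F)).comp γ)
      (pointwiseApply K E F ((⟨f', hc'⟩ : C(E, E →L[ℝ] F)).comp γ)) γ := by
  rw [hasFDerivAt_iff_isLittleO, Asymptotics.isLittleO_iff]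
  intro ε hε
  have hcont : Continuous (fun γ : C(K, E) => (⟨f', hc'⟩ : C(E, E →L[ℝ] F)).comp γ) :=
    ContinuousMap.continuous_postcomp _
  obtain ⟨δ, hδ, H⟩ := (Metric.continuousAt_iff (α := C(K, E))
    (β := C(K, E →L[ℝ] F))).1 (hcont.continuousAt (x := γ)) ε hε
  filter_upwards [Metric.ball_mem_nhds γ hδ] with η hη
  rw [ContinuousMap.norm_le _ (by positivity)]
  intro t
  have hseg : ∀ y ∈ segment ℝ (γ t) (η t), ‖f' y - f' (γ t)‖ ≤ ε := by
    intro y hy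
    rw [segment_eq_image'] at hy
    obtain ⟨s, hs, rfl⟩ := hy
    -- The point of the segment is the value at t of a whole path in the ball, so sup-norm
    -- continuity applies to it.
    have hmem : γ + s • (η - γ) ∈ Metric.ball γ δ := by
      rw [mem_ball_iff_norm, add_sub_cancel_left, norm_smul, Real.norm_of_nonneg hs.1]
      rw [mem_ball_iff_norm] at hη
      exact lt_of_le_of_lt (mul_le_of_le_one_left (norm_nonneg _) hs.2) hη
    rw [← dist_eq_norm]
    exact (ContinuousMap.dist_apply_le_dist t).trans (H hmem).le
  have key := (convex_segment (γ t) (η t)).norm_image_sub_le_of_norm_hasFDerivWithin_le'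
    (fun y _ => (hf y).hasFDerivWithinAt) hseg (left_mem_segment ℝ _ _) (right_mem_segment ℝ _ _)
  refine le_trans key (mul_le_mul_of_nonneg_left ?_ hε.le)
  exact (η - γ).norm_coe_le_norm t

/-- The derivative is again a superposition operator, by `fderiv ℝ f`, followed by a bounded linear
map. The induction therefore has to vary the target space. -/
theorem contDiff_postcomp (n : ℕ) {E F : Type} [NormedAddCommGroup E] [NormedSpace ℝ E]
    [NormedAddCommGroup F] [NormedSpace ℝ F] (f : C(E, F)) (hf : ContDiff ℝ n f) :
    ContDiff ℝ n (fun γ : C(K, E) => f.comp γ) := by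
  induction n generalizing F with
  | zero =>
    rw [Nat.cast_zero, contDiff_zero]
    exact ContinuousMap.continuous_postcomp _
  | succ n ih =>
    rw [Nat.cast_succ] at hf ⊢
    obtain ⟨hdiff, -, hd⟩ := contDiff_succ_iff_fderiv.1 hf
    refine contDiff_succ_iff_hasFDerivAt.2 ⟨_, ?_,
      fun γ => hasFDerivAt_postcomp (fun x => (hdiff x).hasFDerivAt) f.continuous
      hd.continuous γ⟩
    exact (pointwiseApply K E F).contDiff.comp (ih ⟨fderiv ℝ f, hd.continuous⟩ hd)

end Superposition

/-! ### Global flow of a Lipschitz field and its smooth dependence on data and time. -/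

section Flow

open unitInterval

variable {Y : Type} [NormedAddCommGroup Y] [NormedSpace ℝ Y]

/-- The primitive `t ↦ ∫ τ in 0..t, g τ`, as a bounded operator on `C([0, 1], Y)`. -/
noncomputable def volterra (Y : Type) [NormedAddCommGroup Y] [NormedSpace ℝ Y] :
    C(I, Y) →L[ℝ] C(I, Y) :=
  LinearMap.mkContinuous
    { toFun := fun g => ⟨fun t => ∫ τ in (0 : ℝ)..t, IccExtend zero_le_one g τ,
        (intervalIntegral.continuous_primitive
          (fun a b => (g.continuous.Icc_extend').intervalIntegrable a b) 0).comp
            continuous_subtype_val⟩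
      map_add' := fun g h => by
        ext t
        exact intervalIntegral.integral_add ((g.continuous.Icc_extend').intervalIntegrable _ _)
          ((h.continuous.Icc_extend').intervalIntegrable _ _)
      map_smul' := fun c g => by
        ext t
        exact intervalIntegral.integral_smul c _ } 1
    (fun g => by
      rw [one_mul, ContinuousMap.norm_le _ (norm_nonneg _)]
      intro t
      refine (intervalIntegral.norm_integral_le_of_norm_le_const
        (C := ‖g‖) fun τ _ => g.norm_coe_le_norm _).trans ?_
      rw [sub_zero, abs_of_nonneg t.2.1]
      exact mul_le_of_le_one_right (norm_nonneg _) t.2.2)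

theorem volterra_apply (g : C(I, Y)) (t : I) :
    volterra Y g t = ∫ τ in (0 : ℝ)..t, IccExtend zero_le_one g τ := rfl

theorem norm_volterra_le {g : C(I, Y)} {C l : ℝ} (hl : 0 < l)
    (hg : ∀ τ : I, ‖g τ‖ ≤ C * Real.exp (l * τ)) (t : I) :
    ‖volterra Y g t‖ ≤ C / l * Real.exp (l * t) := by
  have hC : 0 ≤ C := by simpa using (norm_nonneg _).trans (hg 0)
  have hd : ∀ s : ℝ, HasDerivAt (fun s => C / l * Real.exp (l * s)) (C * Real.exp (l * s)) s := by
    intro s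
    have := (((hasDerivAt_id s).const_mul l).exp).const_mul (C / l)
    refine this.congr_deriv ?_
    simp only [id]
    field_simp
  have hc : Continuous fun s : ℝ => C * Real.exp (l * s) := by fun_prop
  rw [volterra_apply]
  refine (intervalIntegral.norm_integral_le_of_norm_le t.2.1
    (g := fun s => C * Real.exp (l * s)) ?_ (hc.intervalIntegrable _ _)).trans ?_
  · refine Eventually.of_forall fun s hs => ?_
    have hs' : s ∈ Icc (0 : ℝ) 1 := ⟨hs.1.le, hs.2.trans t.2.2⟩
    rw [IccExtend_of_mem _ _ hs']
    exact hg ⟨s, hs'⟩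
  · rw [intervalIntegral.integral_eq_sub_of_hasDerivAt (fun s _ => hd s)
      (hc.intervalIntegrable _ _)]
    have : 0 ≤ C / l * Real.exp (l * 0) := by positivity
    linarith

/-- Multiplication by the weight `exp (l t)` on `C([0, 1], Y)`. -/
noncomputable def expWeight (Y : Type) [NormedAddCommGroup Y] [NormedSpace ℝ Y] (l : ℝ) :
    C(I, Y) →L[ℝ] C(I, Y) :=
  pointwiseApply I Y Y ⟨fun t => Real.exp (l * t) • ContinuousLinearMap.id ℝ Y, by fun_prop⟩

@[simp]
theorem expWeight_apply (l : ℝ) (g : C(I, Y)) (t : I) :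
    expWeight Y l g t = Real.exp (l * t) • g t := rfl

theorem expWeight_mul_neg (l : ℝ) : expWeight Y l * expWeight Y (-l) = 1 := by
  ext g t
  simp [smul_smul, ← Real.exp_add]

theorem expWeight_neg_mul (l : ℝ) : expWeight Y (-l) * expWeight Y l = 1 := by
  simpa using expWeight_mul_neg (Y := Y) (-l)

/-- Integrating exp(lτ) gains a factor 1/l, so in the weighted norm the Volterra term has constant
|θ|K/l ≤ 1/2. The summand 1 in l keeps l positive when θK = 0. Both the contraction and the
invertibility argument rest on this estimate. -/
theorem norm_expWeight_volterra_le {g : C(I, Y)} {θ K C l : ℝ} (hC : 0 ≤ C)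
    (hl : 2 * (|θ| * K) + 1 = l) (hl0 : 0 < l)
    (hg : ∀ τ : I, ‖g τ‖ ≤ K * C * Real.exp (l * τ)) :
    ‖expWeight Y (-l) (θ • volterra Y g)‖ ≤ 1 / 2 * C := by
  rw [ContinuousMap.norm_le _ (by positivity)]
  intro t
  have h := norm_volterra_le hl0 hg t
  rw [expWeight_apply, ContinuousMap.smul_apply, norm_smul, norm_smul,
    Real.norm_of_nonneg (Real.exp_pos _).le, Real.norm_eq_abs]
  calc Real.exp (-l * t) * (|θ| * ‖volterra Y g t‖)
      ≤ Real.exp (-l * t) * (|θ| * (K * C / l * Real.exp (l * t))) := by gcongr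
    _ = (Real.exp (-l * t) * Real.exp (l * t)) * (|θ| * K / l * C) := by ring
    _ = |θ| * K / l * C := by rw [← Real.exp_add]; simp
    _ ≤ 1 / 2 * C := by
      refine mul_le_mul_of_nonneg_right ?_ hC
      rw [div_le_iff₀ hl0]
      linarith

/-- Conjugation by the exponential weight brings the Volterra operator to norm at most 1/2, and the
Neumann series applies for every θ, however large. -/
theorem isUnit_one_sub_volterra [CompleteSpace Y] (θ : ℝ) {K : ℝ} (A : C(I, Y →L[ℝ] Y))
    (hA : ∀ t, ‖A t‖ ≤ K) :
    IsUnit (1 - θ • (volterra Y).comp (pointwiseApply I Y Y A)) := by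
  have hK : 0 ≤ K := (norm_nonneg _).trans (hA 0)
  obtain ⟨l, hl⟩ : ∃ l, 2 * (|θ| * K) + 1 = l := ⟨_, rfl⟩
  have hl0 : 0 < l := by rw [← hl]; positivity
  set S := θ • (volterra Y).comp (pointwiseApply I Y Y A) with hS
  have hB : ‖expWeight Y (-l) * S * expWeight Y l‖ ≤ 1 / 2 := by
    refine ContinuousLinearMap.opNorm_le_bound _ (by norm_num) fun g => ?_
    refine norm_expWeight_volterra_le
      (g := pointwiseApply I Y Y A (expWeight Y l g)) (norm_nonneg g) hl hl0 fun τ => ?_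
    rw [pointwiseApply_apply, expWeight_apply, map_smul, norm_smul,
      Real.norm_of_nonneg (Real.exp_pos _).le, mul_comm]
    gcongr
    refine ((A τ).le_opNorm _).trans ?_
    have h1 := hA τ
    have h2 := g.norm_coe_le_norm τ
    gcongr
  have hu : IsUnit (1 - expWeight Y (-l) * S * expWeight Y l) :=
    isUnit_one_sub_of_norm_lt_one (R := C(I, Y) →L[ℝ] C(I, Y)) (hB.trans_lt (by norm_num))
  have hW : IsUnit (expWeight Y l) :=
    ⟨⟨_, _, expWeight_mul_neg l, expWeight_neg_mul l⟩, rfl⟩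
  have hW' : IsUnit (expWeight Y (-l)) :=
    ⟨⟨_, _, expWeight_neg_mul l, expWeight_mul_neg l⟩, rfl⟩
  have : 1 - S = expWeight Y l * (1 - expWeight Y (-l) * S * expWeight Y l)
      * expWeight Y (-l) := by
    rw [mul_sub, sub_mul, mul_one, expWeight_mul_neg]
    congr 1
    calc S = (expWeight Y l * expWeight Y (-l)) * S * (expWeight Y l * expWeight Y (-l)) := by
          rw [expWeight_mul_neg]; simp
      _ = _ := by simp only [mul_assoc]
  rw [this]
  exact (hW.mul hu).mul hW'

/-- Constant paths, as a bounded operator. -/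
noncomputable def constPath (Y : Type) [NormedAddCommGroup Y] [NormedSpace ℝ Y] :
    Y →L[ℝ] C(I, Y) :=
  LinearMap.mkContinuous
    { toFun := fun x => ContinuousMap.const I x
      map_add' := fun _ _ => rfl
      map_smul' := fun _ _ => rfl } 1
    (fun x => by
      rw [one_mul, ContinuousMap.norm_le _ (norm_nonneg _)]
      exact fun _ => le_rfl)

@[simp]
theorem constPath_apply (x : Y) (t : I) : constPath Y x t = x := rfl

/-- The Picard map, conjugated by the exponential weight, contracts with ratio 1/2. Time is rescaled
to [0, 1], so that θ enters only as a scalar factor and all paths live in one Banach space. -/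
theorem existsUnique_path [CompleteSpace Y] {K : NNReal} (F : C(Y, Y)) (hF : LipschitzWith K F)
    (x : Y) (θ : ℝ) :
    ∃! γ : C(I, Y), γ = constPath Y x + θ • volterra Y (F.comp γ) := by
  obtain ⟨l, hl⟩ : ∃ l, 2 * (|θ| * (K : ℝ)) + 1 = l := ⟨_, rfl⟩
  have hl0 : 0 < l := by rw [← hl]; positivity
  have h1 : ∀ g, expWeight Y l (expWeight Y (-l) g) = g := fun g =>
    congrArg (fun A : C(I, Y) →L[ℝ] C(I, Y) => A g) (expWeight_mul_neg l)
  have h2 : ∀ g, expWeight Y (-l) (expWeight Y l g) = g := fun g =>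
    congrArg (fun A : C(I, Y) →L[ℝ] C(I, Y) => A g) (expWeight_neg_mul l)
  let T : C(I, Y) → C(I, Y) := fun η =>
    expWeight Y (-l) (constPath Y x + θ • volterra Y (F.comp (expWeight Y l η)))
  have hT : ContractingWith (1 / 2) T := by
    refine ⟨by norm_num, LipschitzWith.of_dist_le_mul fun η ζ => ?_⟩
    have : T η - T ζ = expWeight Y (-l)
        (θ • volterra Y (F.comp (expWeight Y l η) - F.comp (expWeight Y l ζ))) := by
      simp only [T, map_add, map_sub, smul_sub, map_smul]
      abel
    rw [dist_eq_norm (T η), this, dist_eq_norm η]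
    have := norm_expWeight_volterra_le (θ := θ) (K := K)
      (g := F.comp (expWeight Y l η) - F.comp (expWeight Y l ζ)) (norm_nonneg (η - ζ)) hl hl0 ?_
    · simpa using this
    · intro τ
      rw [ContinuousMap.sub_apply, ContinuousMap.comp_apply, ContinuousMap.comp_apply]
      refine (hF.norm_sub_le _ _).trans ?_
      rw [expWeight_apply, expWeight_apply, ← smul_sub, norm_smul,
        Real.norm_of_nonneg (Real.exp_pos _).le, mul_assoc, mul_comm (Real.exp _)]
      gcongr
      exact (η - ζ).norm_coe_le_norm τ
  refine ⟨expWeight Y l hT.fixedPoint, ?_, fun γ hγ => ?_⟩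
  · have := hT.fixedPoint_isFixedPt
    have h3 := congrArg (expWeight Y l) this.symm
    simpa only [T, h1] using h3
  · have : Function.IsFixedPt T (expWeight Y (-l) γ) := by
      change expWeight Y (-l) (constPath Y x + θ • volterra Y
        (F.comp (expWeight Y l (expWeight Y (-l) γ)))) = _
      rw [h1, ← hγ]
    rw [← hT.fixedPoint_unique this, h1]

variable [CompleteSpace Y] {K : NNReal}

/-- The trajectory of `γ' = θ F(γ)`, `γ 0 = x`, over the unit time interval. -/
noncomputable def path (F : C(Y, Y)) (hF : LipschitzWith K F) (x : Y) (θ : ℝ) : C(I, Y) :=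
  (existsUnique_path F hF x θ).choose

/-- The flow of the globally Lipschitz vector field `F`. -/
noncomputable def flow (F : C(Y, Y)) (hF : LipschitzWith K F) (x : Y) (θ : ℝ) : Y :=
  path F hF x θ 1

theorem path_eq (F : C(Y, Y)) (hF : LipschitzWith K F) (x : Y) (θ : ℝ) :
    path F hF x θ = constPath Y x + θ • volterra Y (F.comp (path F hF x θ)) :=
  (existsUnique_path F hF x θ).choose_spec.1

theorem eq_path (F : C(Y, Y)) (hF : LipschitzWith K F) (x : Y) (θ : ℝ) {γ : C(I, Y)}
    (h : γ = constPath Y x + θ • volterra Y (F.comp γ)) : γ = path F hF x θ :=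
  (existsUnique_path F hF x θ).unique h (path_eq F hF x θ)

/-- The path is the zero of Φ, which is Cⁿ jointly in (x, θ, γ). Its partial derivative in γ is
identity minus a Volterra operator, hence invertible, and the implicit function theorem applies. -/
theorem contDiff_path (F : C(Y, Y)) (hF : LipschitzWith K F) {n : ℕ} (hn : n ≠ 0)
    (hFn : ContDiff ℝ n F) : ContDiff ℝ n (fun z : Y × ℝ => path F hF z.1 z.2) := by
  rw [contDiff_iff_contDiffAt]
  intro z
  let Φ : (Y × ℝ) × C(I, Y) → C(I, Y) := fun u =>
    u.2 - (constPath Y u.1.1 + u.1.2 • volterra Y (F.comp u.2))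
  have hcomp := contDiff_postcomp (K := I) n F hFn
  have hΦ : ContDiff ℝ n Φ :=
    contDiff_snd.sub (((constPath Y).contDiff.comp contDiff_fst.fst).add
      (contDiff_fst.snd.smul ((volterra Y).contDiff.comp (hcomp.comp contDiff_snd))))
  set γ := path F hF z.1 z.2
  have hn' : (n : WithTop ℕ∞) ≠ 0 := by exact_mod_cast hn
  have hc' : Continuous (fderiv ℝ F) := hFn.continuous_fderiv hn'
  have hd : ∀ x, HasFDerivAt F (fderiv ℝ F x) x := fun x =>
    ((hFn.differentiable hn') x).hasFDerivAt
  have hpart : (fderiv ℝ Φ (z, γ)).comp (.inr ℝ (Y × ℝ) C(I, Y)) =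
      1 - z.2 • (volterra Y).comp
        (pointwiseApply I Y Y ((⟨fderiv ℝ F, hc'⟩ : C(Y, Y →L[ℝ] Y)).comp γ)) := by
    have ha : HasFDerivAt (fun η => Φ (z, η))
        ((fderiv ℝ Φ (z, γ)).comp (.inr ℝ (Y × ℝ) C(I, Y))) γ :=
      (hΦ.differentiable hn' (z, γ)).hasFDerivAt.comp γ (hasFDerivAt_prodMk_right z γ)
    have hb := (hasFDerivAt_id (𝕜 := ℝ) γ).sub ((((volterra Y).hasFDerivAt.comp γ
      (hasFDerivAt_postcomp hd F.continuous hc' γ)).const_smul z.2).const_add (constPath Y z.1))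
    exact ha.unique hb
  have hinv : ((fderiv ℝ Φ (z, γ)).comp (.inr ℝ (Y × ℝ) C(I, Y))).IsInvertible := by
    rw [hpart]
    obtain ⟨u, hu⟩ := isUnit_one_sub_volterra z.2 (K := K)
      ((⟨fderiv ℝ F, hc'⟩ : C(Y, Y →L[ℝ] Y)).comp γ)
      (fun t => norm_fderiv_le_of_lipschitz ℝ hF)
    rw [← hu]
    exact ⟨ContinuousLinearEquiv.ofUnit u, rfl⟩
  have hat : ContDiffAt ℝ n Φ (z, γ) := hΦ.contDiffAt
  -- The implicit function solves the Picard equation nearby, so global uniqueness of the solution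
  -- identifies it with `path`.
  refine (hat.contDiffAt_implicitFunction hn' hinv).congr_of_eventuallyEq ?_
  filter_upwards [hat.eventually_apply_implicitFunction hn' hinv] with v hv
  have h0 : Φ (z, γ) = 0 := sub_eq_zero.2 (path_eq F hF z.1 z.2)
  rw [h0] at hv
  exact (eq_path F hF v.1 v.2 (sub_eq_zero.1 hv)).symm

theorem contDiff_flow (F : C(Y, Y)) (hF : LipschitzWith K F) {n : ℕ} (hn : n ≠ 0)
    (hFn : ContDiff ℝ n F) : ContDiff ℝ n (fun z : Y × ℝ => flow F hF z.1 z.2) :=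
  (ContinuousMap.evalCLM ℝ (1 : I) : C(I, Y) →L[ℝ] Y).contDiff.comp (contDiff_path F hF hn hFn)

/-- Reparametrizing the path for θ by t ↦ at solves the Picard equation for aθ. This turns the
equation on [0, 1] into the integral equation in the time variable. -/
theorem flow_mul (F : C(Y, Y)) (hF : LipschitzWith K F) (x : Y) (a : I) (θ : ℝ) :
    flow F hF x (a * θ) = path F hF x θ a := by
  let γ : C(I, Y) := ⟨fun t => path F hF x θ (a * t), by fun_prop⟩
  have h : γ = path F hF x (a * θ) := by
    refine eq_path F hF x _ ?_
    ext t
    have h1 : γ t = path F hF x θ (a * t) := rfl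
    rw [h1, path_eq F hF x θ]
    simp only [ContinuousMap.add_apply, ContinuousMap.smul_apply, constPath_apply,
      volterra_apply]
    congr 1
    rw [mul_comm (a : ℝ) θ, mul_smul]
    congr 1
    have h2 : ((a * t : I) : ℝ) = a * t := rfl
    have h3 := intervalIntegral.smul_integral_comp_mul_left (a := (0 : ℝ)) (b := t)
      (fun u => IccExtend zero_le_one (F.comp (path F hF x θ)) u) (a : ℝ)
    rw [mul_zero, ← h2] at h3
    rw [← h3]
    congr 1
    refine intervalIntegral.integral_congr fun u hu => ?_
    rw [uIcc_of_le t.2.1] at hu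
    have hu' : u ∈ Icc (0 : ℝ) 1 := ⟨hu.1, hu.2.trans t.2.2⟩
    have hu2 : (a : ℝ) * u ∈ Icc (0 : ℝ) 1 := (a * ⟨u, hu'⟩ : I).2
    rw [IccExtend_of_mem _ _ hu', IccExtend_of_mem _ _ hu2]
    rfl
  have h4 : path F hF x (a * θ) 1 = γ 1 := by rw [h]
  rw [flow, h4]
  change path F hF x θ (a * 1) = _
  rw [mul_one]

theorem flow_zero (F : C(Y, Y)) (hF : LipschitzWith K F) (x : Y) : flow F hF x 0 = x := by
  rw [flow, path_eq]
  simp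

theorem hasDerivAt_flow (F : C(Y, Y)) (hF : LipschitzWith K F) (x : Y) {n : ℕ} (hn : n ≠ 0)
    (hFn : ContDiff ℝ n F) (θ : ℝ) :
    HasDerivAt (fun s => flow F hF x s) (F (flow F hF x θ)) θ := by
  have hcont : Continuous fun s => F (flow F hF x s) :=
    F.continuous.comp ((contDiff_flow F hF hn hFn).continuous.comp (by fun_prop :
      Continuous fun s : ℝ => (x, s)))
  have key : ∀ s, flow F hF x s = x + ∫ u in (0 : ℝ)..s, F (flow F hF x u) := by
    intro s
    have h3 := intervalIntegral.smul_integral_comp_mul_right (a := (0 : ℝ)) (b := 1)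
      (fun u => F (flow F hF x u)) s
    rw [zero_mul, one_mul] at h3
    rw [← h3]
    conv_lhs => rw [flow, path_eq]
    simp only [ContinuousMap.add_apply, ContinuousMap.smul_apply, constPath_apply,
      volterra_apply]
    congr 2
    refine intervalIntegral.integral_congr fun u hu => ?_
    rw [Icc.coe_one, uIcc_of_le zero_le_one] at hu
    rw [IccExtend_of_mem _ _ hu]
    exact congrArg F (flow_mul F hF x ⟨u, hu⟩ s).symm
  have h := (hcont.integral_hasStrictDerivAt 0 θ).hasDerivAt.const_add x
  exact h.congr_of_eventuallyEq (Eventually.of_forall key)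

end Flow

/-! ### The velocity function and its derivative. -/

section Velocity

/-- The derivative `(1 + p²)^(-3/2)` of the velocity with respect to the momentum. -/
noncomputable def velocityDeriv (p : ℝ) : ℝ := (Real.sqrt (1 + p ^ 2))⁻¹ ^ 3

theorem one_le_sqrt_one_add_sq (p : ℝ) : 1 ≤ Real.sqrt (1 + p ^ 2) :=
  Real.one_le_sqrt.2 (by nlinarith [sq_nonneg p])

theorem hasDerivAt_velocity (p : ℝ) : HasDerivAt velocity (velocityDeriv p) p := by
  have hs : 0 < 1 + p ^ 2 := by positivity
  have h1 := one_le_sqrt_one_add_sq p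
  have h2 : HasDerivAt (fun p : ℝ => 1 + p ^ 2) (2 * p) p := by
    simpa using (hasDerivAt_pow 2 p).const_add 1
  have h3 := (hasDerivAt_id p).div (h2.sqrt hs.ne') (by positivity)
  refine h3.congr_deriv ?_
  have h4 := Real.sq_sqrt hs.le
  simp only [id, velocityDeriv]
  field_simp
  rw [h4]
  ring

theorem contDiff_velocity {n : WithTop ℕ∞} : ContDiff ℝ n velocity := by
  refine contDiff_id.div ((contDiff_const.add (contDiff_id.pow 2)).sqrt fun p => ?_) fun p => ?_
  · simp only [id]; positivity
  · exact (zero_lt_one.trans_le (one_le_sqrt_one_add_sq p)).ne'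

theorem velocityDeriv_pos (p : ℝ) : 0 < velocityDeriv p := by
  have := one_le_sqrt_one_add_sq p
  unfold velocityDeriv
  positivity

theorem velocityDeriv_le_one (p : ℝ) : velocityDeriv p ≤ 1 :=
  pow_le_one₀ (by positivity) (inv_le_one_of_one_le₀ (one_le_sqrt_one_add_sq p))

theorem inv_sqrt_le_of_sq_le {p R : ℝ} (h : p ^ 2 ≤ R) :
    (Real.sqrt (1 + R))⁻¹ ≤ (Real.sqrt (1 + p ^ 2))⁻¹ := by
  have := one_le_sqrt_one_add_sq p
  gcongr

theorem abs_velocity_sub_le (p p' : ℝ) : |velocity p - velocity p'| ≤ |p - p'| := by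
  have h := convex_univ.norm_image_sub_le_of_norm_hasDerivWithin_le (C := 1) (f := velocity)
    (fun x _ => (hasDerivAt_velocity x).hasDerivWithinAt)
    (fun x _ => by
      rw [Real.norm_of_nonneg (velocityDeriv_pos x).le]
      exact velocityDeriv_le_one x) (mem_univ p') (mem_univ p)
  simpa using h

end Velocity

/-! ### The ODE along characteristics and the variational equation. -/

section Characteristics

/-- The vector field `(p, e) ↦ (-e - ν p, V p)` governing the solution along characteristics. -/
noncomputable def characteristicField (ν : ℝ) : C(ℝ × ℝ, ℝ × ℝ) :=
  ⟨fun y => (-y.2 - ν * y.1, velocity y.1), by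
    have := contDiff_velocity (n := 1).continuous
    fun_prop⟩

theorem contDiff_characteristicField (ν : ℝ) {n : WithTop ℕ∞} :
    ContDiff ℝ n (characteristicField ν) :=
  (contDiff_snd.neg.sub (contDiff_const.mul contDiff_fst)).prodMk
    (contDiff_velocity.comp contDiff_fst)

theorem lipschitzWith_characteristicField {ν : ℝ} (hν : 0 ≤ ν) :
    LipschitzWith (1 + ν).toNNReal (characteristicField ν) := by
  refine LipschitzWith.of_dist_le_mul fun y z => ?_
  rw [Real.coe_toNNReal _ (by positivity)]
  have h1 : |y.1 - z.1| ≤ dist y z := by rw [← Real.dist_eq]; exact le_max_left _ _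
  have h2 : |y.2 - z.2| ≤ dist y z := by rw [← Real.dist_eq]; exact le_max_right _ _
  refine max_le ?_ ?_
  · change dist (-y.2 - ν * y.1) (-z.2 - ν * z.1) ≤ _
    rw [Real.dist_eq]
    calc |(-y.2 - ν * y.1) - (-z.2 - ν * z.1)| = |-(y.2 - z.2) + -(ν * (y.1 - z.1))| := by
          congr 1; ring
      _ ≤ |y.2 - z.2| + ν * |y.1 - z.1| := by
          refine (abs_add_le _ _).trans ?_
          rw [abs_neg, abs_neg, abs_mul, abs_of_nonneg hν]
      _ ≤ dist y z + ν * dist y z := by gcongr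
      _ = (1 + ν) * dist y z := by ring
  · change dist (velocity y.1) (velocity z.1) ≤ _
    rw [Real.dist_eq]
    have := abs_velocity_sub_le y.1 z.1
    nlinarith [dist_nonneg (x := y) (y := z)]

/-- `(p, e)` is the solution in Lagrangian coordinates: `p s θ` and `e s θ` are the momentum and
the field at time `θ` on the characteristic issuing from position `s`. -/
structure IsLagrangianSolution (ν : ℝ) (P₀ E₀ : ℝ → ℝ) (p e : ℝ → ℝ → ℝ) : Prop where
  contDiff_p : ContDiff ℝ 2 (fun z : ℝ × ℝ => p z.1 z.2)
  contDiff_e : ContDiff ℝ 2 (fun z : ℝ × ℝ => e z.1 z.2)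
  initial_p : ∀ s, p s 0 = P₀ s
  initial_e : ∀ s, e s 0 = E₀ s
  hasDerivAt_p : ∀ s θ, HasDerivAt (fun t => p s t) (-e s θ - ν * p s θ) θ
  hasDerivAt_e : ∀ s θ, HasDerivAt (fun t => e s t) (velocity (p s θ)) θ

theorem exists_isLagrangianSolution {ν : ℝ} (hν : 0 ≤ ν) {P₀ E₀ : ℝ → ℝ}
    (hP₀ : ContDiff ℝ 2 P₀) (hE₀ : ContDiff ℝ 2 E₀) :
    ∃ p e, IsLagrangianSolution ν P₀ E₀ p e := by
  have hF := lipschitzWith_characteristicField hν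
  have hFn : ContDiff ℝ (2 : ℕ) (characteristicField ν) := contDiff_characteristicField ν
  let u : ℝ × ℝ → ℝ × ℝ := fun z => flow (characteristicField ν) hF (P₀ z.1, E₀ z.1) z.2
  have hu : ContDiff ℝ 2 u :=
    (contDiff_flow _ hF two_ne_zero hFn).comp
      (((hP₀.comp contDiff_fst).prodMk (hE₀.comp contDiff_fst)).prodMk contDiff_snd)
  have hd : ∀ s θ, HasDerivAt (fun t => u (s, t)) (characteristicField ν (u (s, θ))) θ :=
    fun s θ => hasDerivAt_flow _ hF (P₀ s, E₀ s) two_ne_zero hFn θ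
  have h0 : ∀ s, u (s, 0) = (P₀ s, E₀ s) := fun s => flow_zero _ hF _
  exact ⟨fun s θ => (u (s, θ)).1, fun s θ => (u (s, θ)).2,
    { contDiff_p := contDiff_fst.comp hu
      contDiff_e := contDiff_snd.comp hu
      initial_p := fun s => by rw [h0]
      initial_e := fun s => by rw [h0]
      hasDerivAt_p := fun s θ => (ContinuousLinearMap.fst ℝ ℝ ℝ).hasFDerivAt.comp_hasDerivAt θ (hd s θ)
      hasDerivAt_e := fun s θ => (ContinuousLinearMap.snd ℝ ℝ ℝ).hasFDerivAt.comp_hasDerivAt θ (hd s θ) }⟩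

theorem hasDerivAt_fst_slice {f : ℝ → ℝ → ℝ} {s θ : ℝ}
    (hf : DifferentiableAt ℝ (fun z : ℝ × ℝ => f z.1 z.2) (s, θ)) :
    HasDerivAt (fun r => f r θ) (fderiv ℝ (fun z : ℝ × ℝ => f z.1 z.2) (s, θ) (1, 0)) s :=
  hf.hasFDerivAt.comp_hasDerivAt (f := fun r : ℝ => (r, θ)) s
    ((hasDerivAt_id s).prodMk (hasDerivAt_const s θ))

theorem hasDerivAt_snd_slice {f : ℝ → ℝ → ℝ} {s θ : ℝ}
    (hf : DifferentiableAt ℝ (fun z : ℝ × ℝ => f z.1 z.2) (s, θ)) :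
    HasDerivAt (fun t => f s t) (fderiv ℝ (fun z : ℝ × ℝ => f z.1 z.2) (s, θ) (0, 1)) θ :=
  hf.hasFDerivAt.comp_hasDerivAt (f := fun t : ℝ => (s, t)) θ
    ((hasDerivAt_const θ s).prodMk (hasDerivAt_id θ))

/-- Exchange of the two partial derivatives of a `C²` function, in the form of a derivation of the
variational equation. -/
theorem hasDerivAt_deriv_of_hasDerivAt {f g : ℝ → ℝ → ℝ} {s θ g' : ℝ}
    (hf : ContDiff ℝ 2 (fun z : ℝ × ℝ => f z.1 z.2))
    (hg : ∀ s θ, HasDerivAt (fun t => f s t) (g s θ) θ)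
    (hg' : HasDerivAt (fun r => g r θ) g' s) :
    HasDerivAt (fun t => deriv (fun r => f r t) s) g' θ := by
  set f' := fderiv ℝ (fun z : ℝ × ℝ => f z.1 z.2) with hf'
  have hdf : Differentiable ℝ (fun z : ℝ × ℝ => f z.1 z.2) := hf.differentiable two_ne_zero
  have hdf' : Differentiable ℝ f' := (hf.fderiv_right (m := 1) (by norm_num)).differentiable
    one_ne_zero
  have e1 : ∀ t, deriv (fun r => f r t) s = f' (s, t) (1, 0) := fun t =>
    (hasDerivAt_fst_slice (hdf (s, t))).deriv
  have e2 : ∀ r, g r θ = f' (r, θ) (0, 1) := fun r =>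
    (hg r θ).unique (hasDerivAt_snd_slice (hdf (r, θ)))
  have h1 : HasDerivAt (fun t => f' (s, t)) (fderiv ℝ f' (s, θ) (0, 1)) θ :=
    (hdf' (s, θ)).hasFDerivAt.comp_hasDerivAt (f := fun t : ℝ => (s, t)) θ
      ((hasDerivAt_const θ s).prodMk (hasDerivAt_id θ))
  have h2 : HasDerivAt (fun r => f' (r, θ)) (fderiv ℝ f' (s, θ) (1, 0)) s :=
    (hdf' (s, θ)).hasFDerivAt.comp_hasDerivAt (f := fun r : ℝ => (r, θ)) s
      ((hasDerivAt_id s).prodMk (hasDerivAt_const s θ))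
  have h3 : HasDerivAt (fun r => f' (r, θ) (0, 1)) (fderiv ℝ f' (s, θ) (1, 0) (0, 1)) s := by
    simpa using h2.clm_apply (hasDerivAt_const s ((0, 1) : ℝ × ℝ))
  have h4 : HasDerivAt (fun t => f' (s, t) (1, 0)) (fderiv ℝ f' (s, θ) (0, 1) (1, 0)) θ := by
    simpa using h1.clm_apply (hasDerivAt_const θ ((1, 0) : ℝ × ℝ))
  have hsymm : fderiv ℝ f' (s, θ) (0, 1) (1, 0) = fderiv ℝ f' (s, θ) (1, 0) (0, 1) :=
    (hf.contDiffAt.isSymmSndFDerivAt (by simp)) _ _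
  simp only [e1]
  simp only [e2] at hg'
  rw [← h3.unique hg', ← hsymm]
  exact h4

end Characteristics

/-! ### The damped linear system: decay and positivity. -/

section LinearDamping

/-- Exponential decay for the damped system `q' = -w - ν q`, `w' = k q` with `c ≤ k ≤ 1`. -/
theorem sq_add_sq_le_of_damped {ν c : ℝ} {k q w : ℝ → ℝ} (hν : 2 ≤ ν) (hc : 0 ≤ c)
    (hck : ∀ θ, 0 ≤ θ → c ≤ k θ) (hk1 : ∀ θ, 0 ≤ θ → k θ ≤ 1)
    (hq : ∀ θ, HasDerivAt q (-w θ - ν * q θ) θ) (hw : ∀ θ, HasDerivAt w (k θ * q θ) θ)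
    {θ : ℝ} (hθ : 0 ≤ θ) :
    q θ ^ 2 + w θ ^ 2 ≤ 8 * (q 0 ^ 2 + w 0 ^ 2) * Real.exp (-(c / (2 * ν) * θ)) := by
  have hν0 : 0 < ν := by linarith
  have hμ0 : 0 < 1 / (2 * ν) := by positivity
  have hμ : 1 / (2 * ν) ≤ 1 / 4 := by
    rw [div_le_div_iff₀ (by positivity) (by positivity)]; linarith
  -- The cross term supplies dissipation in w, which the damping alone does not give. The weight
  -- 1/(2ν) ≤ 1/4 keeps L positive definite and makes the derivative below a combination of squares.
  set L : ℝ → ℝ := fun t => w t ^ 2 / 2 + q t ^ 2 / 4 + 1 / (2 * ν) * (w t * q t) with hL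
  have hlow : ∀ t, (q t ^ 2 + w t ^ 2) / 8 ≤ L t := by
    intro t
    have h1 : -(1 / 4 * |w t * q t|) ≤ 1 / (2 * ν) * (w t * q t) := by
      have := neg_abs_le (w t * q t)
      nlinarith [abs_nonneg (w t * q t)]
    have h2 : |w t * q t| ≤ (q t ^ 2 + w t ^ 2) / 2 := by
      rw [abs_le]; constructor <;> nlinarith [sq_nonneg (w t + q t), sq_nonneg (w t - q t)]
    simp only [hL]
    nlinarith [sq_nonneg (w t), sq_nonneg (q t)]
  have hup : ∀ t, L t ≤ q t ^ 2 + w t ^ 2 := by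
    intro t
    have h1 : 1 / (2 * ν) * (w t * q t) ≤ 1 / 4 * |w t * q t| := by
      have := le_abs_self (w t * q t)
      nlinarith [abs_nonneg (w t * q t)]
    have h2 : |w t * q t| ≤ (q t ^ 2 + w t ^ 2) / 2 := by
      rw [abs_le]; constructor <;> nlinarith [sq_nonneg (w t + q t), sq_nonneg (w t - q t)]
    simp only [hL]
    nlinarith [sq_nonneg (w t), sq_nonneg (q t)]
  set D : ℝ → ℝ := fun t =>
    -(1 / (2 * ν) * ((1 - k t) * (w t + ν * q t) ^ 2 + k t * w t ^ 2
      + k t * (ν ^ 2 - 1) * q t ^ 2)) with hD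
  have hLd : ∀ t, HasDerivAt L (D t) t := by
    intro t
    have h := ((((hw t).pow 2).div_const 2).add (((hq t).pow 2).div_const 4)).add
      (((hw t).mul (hq t)).const_mul (1 / (2 * ν)))
    refine h.congr_deriv ?_
    simp only [hD]
    field_simp
    ring
  have hDL : ∀ t, 0 ≤ t → D t ≤ -(c / (2 * ν) * L t) := by
    intro t ht
    have hk := hck t ht
    have hk' := hk1 t ht
    have h1 : c * L t ≤ c * (q t ^ 2 + w t ^ 2) := mul_le_mul_of_nonneg_left (hup t) hc
    have h2 : c * (q t ^ 2 + w t ^ 2) ≤ k t * (q t ^ 2 + w t ^ 2) :=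
      mul_le_mul_of_nonneg_right hk (by positivity)
    have h3 : k t * q t ^ 2 ≤ k t * (ν ^ 2 - 1) * q t ^ 2 := by
      have : 1 ≤ ν ^ 2 - 1 := by nlinarith
      have : k t * 1 ≤ k t * (ν ^ 2 - 1) :=
        mul_le_mul_of_nonneg_left this (hc.trans hk)
      nlinarith [sq_nonneg (q t)]
    have h4 : 0 ≤ (1 - k t) * (w t + ν * q t) ^ 2 :=
      mul_nonneg (by linarith) (sq_nonneg _)
    have h5 : c / (2 * ν) * L t = 1 / (2 * ν) * (c * L t) := by ring
    rw [h5]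
    simp only [hD]
    refine neg_le_neg (mul_le_mul_of_nonneg_left ?_ hμ0.le)
    linarith
  have hGd : ∀ t, HasDerivAt (fun t => L t * Real.exp (c / (2 * ν) * t))
      ((D t + c / (2 * ν) * L t) * Real.exp (c / (2 * ν) * t)) t := by
    intro t
    have h := (hLd t).mul ((hasDerivAt_id t).const_mul (c / (2 * ν))).exp
    refine h.congr_deriv ?_
    simp only [id]
    ring
  have hanti : AntitoneOn (fun t => L t * Real.exp (c / (2 * ν) * t)) (Ici 0) := by
    refine antitoneOn_of_deriv_nonpos (convex_Ici 0)
      (fun t _ => (hGd t).continuousAt.continuousWithinAt)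
      (fun t _ => (hGd t).differentiableAt.differentiableWithinAt) fun t ht => ?_
    rw [interior_Ici] at ht
    rw [(hGd t).deriv]
    have := hDL t (le_of_lt ht)
    exact mul_nonpos_of_nonpos_of_nonneg (by linarith) (Real.exp_pos _).le
  have h := hanti (mem_Ici.2 le_rfl) (mem_Ici.2 hθ) hθ
  simp only [mul_zero, Real.exp_zero, mul_one] at h
  have h6 : L θ ≤ L 0 * Real.exp (-(c / (2 * ν) * θ)) := by
    rw [Real.exp_neg, ← div_eq_mul_inv, le_div_iff₀ (Real.exp_pos _)]
    exact h
  have h7 : L 0 * Real.exp (-(c / (2 * ν) * θ)) ≤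
      (q 0 ^ 2 + w 0 ^ 2) * Real.exp (-(c / (2 * ν) * θ)) :=
    mul_le_mul_of_nonneg_right (hup 0) (Real.exp_pos _).le
  linarith [hlow θ]

/-- For large damping the linear system `q' = -w - ν q`, `w' = k q` keeps `n + w` positive. -/
theorem add_pos_of_damped {ν m n : ℝ} {k q w : ℝ → ℝ} (hm : 1 ≤ m) (hν : m + 1 ≤ ν) (hn : 0 < n)
    (hk0 : ∀ θ, 0 ≤ k θ) (hk1 : ∀ θ, k θ ≤ 1)
    (hq : ∀ θ, HasDerivAt q (-w θ - ν * q θ) θ) (hw : ∀ θ, HasDerivAt w (k θ * q θ) θ)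
    (hq0 : -m ≤ q 0) (hw0 : n + w 0 = 1) {θ : ℝ} (hθ : 0 ≤ θ) : 0 < n + w θ := by
  by_contra! hneg
  have hwc : Continuous w := continuous_iff_continuousAt.2 fun t => (hw t).continuousAt
  have hqc : Continuous q := continuous_iff_continuousAt.2 fun t => (hq t).continuousAt
  have hcomp : IsCompact (Icc 0 θ ∩ {t | n + w t ≤ 0}) :=
    isCompact_Icc.inter_right (isClosed_le (by fun_prop) (by fun_prop))
  -- The first time b at which n + w fails to be positive.
  obtain ⟨b, ⟨hb, hb0⟩, hleast⟩ := hcomp.exists_isLeast ⟨θ, ⟨hθ, le_rfl⟩, hneg⟩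
  have hx : ∀ t ∈ Ico 0 b, 0 < n + w t := by
    intro t ht
    by_contra! h
    exact absurd (hleast ⟨⟨ht.1, ht.2.le.trans hb.2⟩, h⟩) (not_le.2 ht.2)
  -- The barrier q = -m(n + w) cannot be crossed before b: on it the derivative of the left side is
  -- -(νm - m²k - 1)(n + w) - n, which is negative because νm ≥ m² + m ≥ m²k + 1 and n > 0.
  have hz : ∀ t ∈ Icc 0 b, -(q t + m * (n + w t)) ≤ 0 := by
    have hzd : ∀ t, HasDerivAt (fun t => -(q t + m * (n + w t)))
        (-((-w t - ν * q t) + m * (k t * q t))) t := fun t =>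
      ((hq t).add (((hw t).const_add n).const_mul m)).neg
    refine image_le_of_deriv_right_lt_deriv_boundary (B := fun _ => 0) (B' := fun _ => 0)
      (fun t _ => (hzd t).continuousAt.continuousWithinAt)
      (fun t _ => (hzd t).hasDerivWithinAt) ?_ (fun t => hasDerivAt_const t 0) ?_
    · rw [hw0]; linarith
    · intro t ht h0
      have hxt := hx t ht
      have hqt : q t = -(m * (n + w t)) := by linarith
      have h1 : 0 ≤ ν * m - m ^ 2 * k t - 1 := by
        nlinarith [mul_le_mul_of_nonneg_left (hk1 t) (sq_nonneg m)]
      have h2 := mul_nonneg h1 hxt.le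
      rw [hqt]
      nlinarith
  have hgd : ∀ t, HasDerivAt (fun t => (n + w t) * Real.exp (m * t))
      ((k t * q t + m * (n + w t)) * Real.exp (m * t)) t := by
    intro t
    refine (((hw t).const_add n).mul ((hasDerivAt_id t).const_mul m).exp).congr_deriv ?_
    simp only [id]
    ring
  -- Above the barrier, w' = kq ≥ -m(n + w). Hence n + w ≥ exp(-mt) on [0, b], contradicting the
  -- choice of b.
  have hmono : MonotoneOn (fun t => (n + w t) * Real.exp (m * t)) (Icc 0 b) := by
    refine monotoneOn_of_deriv_nonneg (convex_Icc 0 b)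
      (fun t _ => (hgd t).continuousAt.continuousWithinAt)
      (fun t _ => (hgd t).differentiableAt.differentiableWithinAt) fun t ht => ?_
    rw [interior_Icc] at ht
    rw [(hgd t).deriv]
    refine mul_nonneg ?_ (Real.exp_pos _).le
    have h1 := hz t ⟨ht.1.le, ht.2.le⟩
    have h2 := hx t ⟨ht.1.le, ht.2⟩
    have h3 : k t * -(m * (n + w t)) ≤ k t * q t :=
      mul_le_mul_of_nonneg_left (by linarith) (hk0 t)
    have h4 : 0 ≤ (1 - k t) * (m * (n + w t)) :=
      mul_nonneg (by linarith [hk1 t]) (by positivity)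
    linarith
  have h := hmono ⟨le_rfl, hb.1⟩ ⟨hb.1, le_rfl⟩ hb.1
  simp only [mul_zero, Real.exp_zero, mul_one, hw0] at h
  have hb0' : n + w b ≤ 0 := hb0
  nlinarith [Real.exp_pos (m * b)]

end LinearDamping

/-! ### The position map, its inverse, and estimates along characteristics. -/

section Eulerian

/-- The chain rule along a curve `t ↦ (x t, t)`, in terms of partial derivatives. -/
theorem hasDerivAt_along_curve {f : ℝ → ℝ → ℝ} {x : ℝ → ℝ} {x' θ : ℝ}
    (hf : DifferentiableAt ℝ (fun z : ℝ × ℝ => f z.1 z.2) (x θ, θ)) (hx : HasDerivAt x x' θ) :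
    HasDerivAt (fun t => f (x t) t)
      (deriv (fun t => f (x θ) t) θ + x' * deriv (fun r => f r θ) (x θ)) θ := by
  have h := hf.hasFDerivAt.comp_hasDerivAt (f := fun t : ℝ => (x t, t)) θ
    (hx.prodMk (hasDerivAt_id θ))
  refine h.congr_deriv ?_
  rw [(hasDerivAt_snd_slice hf).deriv, (hasDerivAt_fst_slice hf).deriv, ← smul_eq_mul x',
    ← map_smul, ← map_add]
  simp

/-- The global inverse of a family of increasing bijections is as smooth as the family. -/
theorem contDiffOn_inverse_family {X Y : ℝ → ℝ → ℝ}
    (hX : ContDiff ℝ 2 (fun z : ℝ × ℝ => X z.1 z.2))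
    (hpos : ∀ s θ, 0 ≤ θ → 0 < deriv (fun r => X r θ) s)
    (hXY : ∀ ρ θ, 0 ≤ θ → X (Y ρ θ) θ = ρ) (hYX : ∀ s θ, 0 ≤ θ → Y (X s θ) θ = s) :
    ContDiffOn ℝ 2 (fun z : ℝ × ℝ => Y z.1 z.2) (univ ×ˢ Ici 0) := by
  rintro ⟨ρ, θ⟩ ⟨-, hθ⟩
  set s := Y ρ θ with hs
  have hXs : X s θ = ρ := hXY ρ θ hθ
  set Ψ : ℝ × ℝ → ℝ × ℝ := fun z => (X z.1 z.2, z.2) with hΨ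
  have hΨc : ContDiff ℝ 2 Ψ := hX.prodMk contDiff_snd
  set A := fderiv ℝ (fun z : ℝ × ℝ => X z.1 z.2) (s, θ) with hA
  have hXd : HasFDerivAt (fun z : ℝ × ℝ => X z.1 z.2) A (s, θ) :=
    (hX.differentiable two_ne_zero (s, θ)).hasFDerivAt
  have hA1 : A (1, 0) ≠ 0 := by
    rw [← (hasDerivAt_fst_slice hXd.differentiableAt).deriv]
    exact (hpos s θ hθ).ne'
  have hΨd : HasFDerivAt Ψ (A.prod (.snd ℝ ℝ ℝ)) (s, θ) := hXd.prodMk hasFDerivAt_snd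
  have hsplit : ∀ v : ℝ × ℝ, A v = v.1 * A (1, 0) + v.2 * A (0, 1) := by
    intro v
    rw [← smul_eq_mul, ← smul_eq_mul, ← map_smul, ← map_smul, ← map_add]
    simp
  -- The differential of (s, θ) ↦ (X s θ, θ) is triangular with diagonal entries ∂ₛX > 0 and 1.
  have hker : LinearMap.ker (A.prod (.snd ℝ ℝ ℝ) : ℝ × ℝ →ₗ[ℝ] ℝ × ℝ) = ⊥ := by
    rw [LinearMap.ker_eq_bot']
    intro v hv
    have h2 : v.2 = 0 := congrArg Prod.snd hv
    have h1 : A v = 0 := congrArg Prod.fst hv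
    rw [hsplit, h2, zero_mul, add_zero] at h1
    exact Prod.ext ((mul_eq_zero.1 h1).resolve_right hA1) h2
  let e : (ℝ × ℝ) ≃L[ℝ] ℝ × ℝ := (LinearEquiv.ofInjectiveEndo
    (A.prod (.snd ℝ ℝ ℝ) : ℝ × ℝ →ₗ[ℝ] ℝ × ℝ)
    (LinearMap.ker_eq_bot.1 hker)).toContinuousLinearEquiv
  have he : HasFDerivAt Ψ (e : ℝ × ℝ →L[ℝ] ℝ × ℝ) (s, θ) := by
    have : (e : ℝ × ℝ →L[ℝ] ℝ × ℝ) = A.prod (.snd ℝ ℝ ℝ) := ContinuousLinearMap.ext fun v => rfl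
    rwa [this]
  have hat : ContDiffAt ℝ 2 Ψ (s, θ) := hΨc.contDiffAt
  have hΨs : Ψ (s, θ) = (ρ, θ) := by simp only [hΨ, hXs]
  have hloc := hat.to_localInverse he two_ne_zero
  rw [hΨs] at hloc
  have hright : ∀ᶠ z in 𝓝 (ρ, θ), Ψ (hat.localInverse he two_ne_zero z) = z := by
    rw [← hΨs]
    exact (hat.hasStrictFDerivAt' he two_ne_zero).eventually_right_inverse
  -- The local inverse exists on a full neighbourhood, even at θ = 0, but agrees with `Y` only where
  -- θ ≥ 0; hence smoothness within the closed half-plane.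
  refine (contDiff_fst.contDiffAt.comp _ hloc).contDiffWithinAt.congr_of_eventuallyEq ?_ ?_
  · filter_upwards [mem_nhdsWithin_of_mem_nhds hright, self_mem_nhdsWithin] with z hz hz0
    obtain ⟨h1, h2⟩ := Prod.ext_iff.1 hz
    simp only [hΨ] at h1 h2
    rw [h2] at h1
    change Y z.1 z.2 = (hat.localInverse he two_ne_zero z).1
    rw [← h1, hYX _ _ hz0.2]
  · have h1 := hat.localInverse_apply_image he two_ne_zero
    rw [hΨs] at h1
    simp only [Function.comp_apply]
    rw [h1]

/-- The position at time `θ` of the characteristic issuing from `s`. -/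
def position (E₀ : ℝ → ℝ) (e : ℝ → ℝ → ℝ) (s θ : ℝ) : ℝ := s - E₀ s + e s θ

namespace IsLagrangianSolution

variable {ν : ℝ} {P₀ E₀ : ℝ → ℝ} {p e : ℝ → ℝ → ℝ}

theorem contDiff_position (h : IsLagrangianSolution ν P₀ E₀ p e) (hE₀ : ContDiff ℝ 2 E₀) :
    ContDiff ℝ 2 (fun z : ℝ × ℝ => position E₀ e z.1 z.2) :=
  (contDiff_fst.sub (hE₀.comp contDiff_fst)).add h.contDiff_e

theorem position_zero (h : IsLagrangianSolution ν P₀ E₀ p e) (s : ℝ) : position E₀ e s 0 = s := by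
  simp [position, h.initial_e]

/-- Position minus field is constant along a characteristic, so the trajectory needs no separate
integration. -/
theorem hasDerivAt_position (h : IsLagrangianSolution ν P₀ E₀ p e) (s θ : ℝ) :
    HasDerivAt (fun t => position E₀ e s t) (velocity (p s θ)) θ :=
  (h.hasDerivAt_e s θ).const_add _

theorem hasDerivAt_p_fst (h : IsLagrangianSolution ν P₀ E₀ p e) (s θ : ℝ) :
    HasDerivAt (fun r => p r θ) (deriv (fun r => p r θ) s) s :=
  (hasDerivAt_fst_slice (h.contDiff_p.differentiable two_ne_zero _)).differentiableAt.hasDerivAt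

theorem hasDerivAt_e_fst (h : IsLagrangianSolution ν P₀ E₀ p e) (s θ : ℝ) :
    HasDerivAt (fun r => e r θ) (deriv (fun r => e r θ) s) s :=
  (hasDerivAt_fst_slice (h.contDiff_e.differentiable two_ne_zero _)).differentiableAt.hasDerivAt

theorem hasDerivAt_position_fst (h : IsLagrangianSolution ν P₀ E₀ p e) (hE₀ : ContDiff ℝ 2 E₀)
    (s θ : ℝ) :
    HasDerivAt (fun r => position E₀ e r θ) (density E₀ s + deriv (fun r => e r θ) s) s :=
  ((hasDerivAt_id s).sub (hE₀.differentiable two_ne_zero s).hasDerivAt).add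
    (h.hasDerivAt_e_fst s θ)

theorem hasDerivAt_deriv_p (h : IsLagrangianSolution ν P₀ E₀ p e) (s θ : ℝ) :
    HasDerivAt (fun t => deriv (fun r => p r t) s)
      (-deriv (fun r => e r θ) s - ν * deriv (fun r => p r θ) s) θ :=
  hasDerivAt_deriv_of_hasDerivAt h.contDiff_p h.hasDerivAt_p
    ((h.hasDerivAt_e_fst s θ).neg.sub ((h.hasDerivAt_p_fst s θ).const_mul ν))

theorem hasDerivAt_deriv_e (h : IsLagrangianSolution ν P₀ E₀ p e) (s θ : ℝ) :
    HasDerivAt (fun t => deriv (fun r => e r t) s)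
      (velocityDeriv (p s θ) * deriv (fun r => p r θ) s) θ :=
  hasDerivAt_deriv_of_hasDerivAt h.contDiff_e h.hasDerivAt_e
    ((hasDerivAt_velocity _).comp s (h.hasDerivAt_p_fst s θ))

theorem deriv_p_zero (h : IsLagrangianSolution ν P₀ E₀ p e) (s : ℝ) :
    deriv (fun r => p r 0) s = deriv P₀ s := by simp only [h.initial_p]

theorem deriv_e_zero (h : IsLagrangianSolution ν P₀ E₀ p e) (s : ℝ) :
    deriv (fun r => e r 0) s = deriv E₀ s := by simp only [h.initial_e]

/-- Initially the Jacobian is (1 - E₀') + E₀' = 1, so the barrier condition reduces to -m ≤ P₀',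
uniformly in s. -/
theorem density_add_pos (h : IsLagrangianSolution ν P₀ E₀ p e) {m : ℝ} (hm : 1 ≤ m)
    (hν : m + 1 ≤ ν) (hQ : ∀ s, -m ≤ deriv P₀ s) (hN : ∀ s, 0 < density E₀ s) (s θ : ℝ)
    (hθ : 0 ≤ θ) : 0 < density E₀ s + deriv (fun r => e r θ) s := by
  refine add_pos_of_damped hm hν (hN s) (fun t => (velocityDeriv_pos (p s t)).le)
    (fun t => velocityDeriv_le_one (p s t)) (h.hasDerivAt_deriv_p s) (h.hasDerivAt_deriv_e s)
    ?_ ?_ hθ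
  · rw [h.deriv_p_zero]; exact hQ s
  · rw [h.deriv_e_zero, density]; ring

/-- Writing V(p) as a coefficient in (0, 1] times p puts the nonlinear system in the damped linear
form. -/
theorem hasDerivAt_e' (h : IsLagrangianSolution ν P₀ E₀ p e) (s θ : ℝ) :
    HasDerivAt (fun t => e s t) ((Real.sqrt (1 + p s θ ^ 2))⁻¹ * p s θ) θ := by
  rw [mul_comm, ← div_eq_mul_inv]
  exact h.hasDerivAt_e s θ

/-- The case c = 0 of the damping estimate. This a priori bound on p provides the positive lower
bound on k needed for actual decay. -/
theorem sq_add_sq_le (h : IsLagrangianSolution ν P₀ E₀ p e) (hν : 2 ≤ ν) (s : ℝ) {θ : ℝ}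
    (hθ : 0 ≤ θ) : p s θ ^ 2 + e s θ ^ 2 ≤ 8 * (P₀ s ^ 2 + E₀ s ^ 2) := by
  have := sq_add_sq_le_of_damped (c := 0) hν le_rfl
    (k := fun t => (Real.sqrt (1 + p s t ^ 2))⁻¹) (fun t _ => by positivity)
    (fun t _ => inv_le_one_of_one_le₀ (one_le_sqrt_one_add_sq _)) (h.hasDerivAt_p s)
    (h.hasDerivAt_e' s) hθ
  simpa [h.initial_p, h.initial_e] using this

/-- Uniform exponential decay along characteristics, of the solution and of its derivatives with
respect to the initial position. -/
theorem exists_decay (h : IsLagrangianSolution ν P₀ E₀ p e) (hν : 2 ≤ ν) {R : ℝ}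
    (hR : ∀ s, P₀ s ^ 2 + E₀ s ^ 2 ≤ R) :
    ∃ a > 0, ∀ s θ, 0 ≤ θ →
      p s θ ^ 2 + e s θ ^ 2 ≤ 8 * R * Real.exp (-(a * θ)) ∧
      deriv (fun r => p r θ) s ^ 2 + deriv (fun r => e r θ) s ^ 2 ≤
        8 * (deriv P₀ s ^ 2 + deriv E₀ s ^ 2) * Real.exp (-(a * θ)) := by
  have hR0 : 0 ≤ R := (by positivity : 0 ≤ P₀ 0 ^ 2 + E₀ 0 ^ 2).trans (hR 0)
  set b := (Real.sqrt (1 + 8 * R))⁻¹ with hb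
  have hb0 : 0 < b := by positivity
  have hb1 : b ≤ 1 := inv_le_one_of_one_le₀ (Real.one_le_sqrt.2 (by linarith))
  have hbp : ∀ s t, 0 ≤ t → b ≤ (Real.sqrt (1 + p s t ^ 2))⁻¹ := fun s t ht =>
    inv_sqrt_le_of_sq_le (by nlinarith [h.sq_add_sq_le hν s ht, hR s, sq_nonneg (e s t)])
  -- The coefficient is at least b for (p, e) and at least b³ for the derivatives; as b ≤ 1, the
  -- value b³ gives a common rate.
  refine ⟨b ^ 3 / (2 * ν), by positivity, fun s θ hθ => ⟨?_, ?_⟩⟩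
  · have h1 := sq_add_sq_le_of_damped (c := b ^ 3) hν (by positivity)
      (k := fun t => (Real.sqrt (1 + p s t ^ 2))⁻¹)
      (fun t ht => (pow_le_of_le_one hb0.le hb1 three_ne_zero).trans (hbp s t ht))
      (fun t _ => inv_le_one_of_one_le₀ (one_le_sqrt_one_add_sq _)) (h.hasDerivAt_p s)
      (h.hasDerivAt_e' s) hθ
    rw [h.initial_p, h.initial_e] at h1
    refine h1.trans ?_
    have := hR s
    gcongr
  · have h1 := sq_add_sq_le_of_damped (c := b ^ 3) hν (by positivity)
      (k := fun t => velocityDeriv (p s t))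
      (fun t ht => pow_le_pow_left₀ hb0.le (hbp s t ht) 3)
      (fun t _ => velocityDeriv_le_one _) (h.hasDerivAt_deriv_p s)
      (h.hasDerivAt_deriv_e s) hθ
    rwa [h.deriv_p_zero, h.deriv_e_zero] at h1

/-- The position map is continuous and at bounded distance from the identity. -/
theorem surjective_position (h : IsLagrangianSolution ν P₀ E₀ p e) (hE₀ : ContDiff ℝ 2 E₀)
    {C θ : ℝ} (hC : ∀ s, |e s θ - E₀ s| ≤ C) :
    Function.Surjective (fun s => position E₀ e s θ) := by
  have hcont : Continuous (fun s => position E₀ e s θ) :=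
    (h.contDiff_position hE₀).continuous.comp (f := fun s : ℝ => (s, θ)) (by fun_prop)
  refine hcont.surjective ?_ ?_
  · refine tendsto_atTop_mono (fun s => ?_) (tendsto_atTop_add_const_right atTop (-C) tendsto_id)
    have := (abs_le.1 (hC s)).1
    simp only [position, id]
    linarith
  · refine tendsto_atBot_mono (fun s => ?_) (tendsto_atBot_add_const_right atBot C tendsto_id)
    have := (abs_le.1 (hC s)).2
    simp only [position, id]
    linarith

end IsLagrangianSolution

end Eulerian

/-! ### Return to Eulerian coordinates: existence, uniqueness, stabilization. -/

namespace IsLagrangianSolution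

variable {ν : ℝ} {P₀ E₀ : ℝ → ℝ} {p e : ℝ → ℝ → ℝ} {Y : ℝ → ℝ → ℝ}

/-- Each equation results from computing the derivative along a characteristic twice, by the chain
rule and by the ODE. -/
theorem isClassicalSolution (h : IsLagrangianSolution ν P₀ E₀ p e)
    (hXY : ∀ ρ θ, 0 ≤ θ → position E₀ e (Y ρ θ) θ = ρ)
    (hYX : ∀ s θ, 0 ≤ θ → Y (position E₀ e s θ) θ = s)
    (hY : ContDiffOn ℝ 2 (fun z : ℝ × ℝ => Y z.1 z.2) (univ ×ˢ Ici 0)) :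
    IsClassicalSolution 2 ν P₀ E₀ (Ici 0) (fun ρ θ => p (Y ρ θ) θ) (fun ρ θ => e (Y ρ θ) θ) := by
  have hP : ContDiffOn ℝ 2 (fun z : ℝ × ℝ => p (Y z.1 z.2) z.2) (univ ×ˢ Ici 0) :=
    h.contDiff_p.comp_contDiffOn (hY.prodMk contDiffOn_snd)
  have hE : ContDiffOn ℝ 2 (fun z : ℝ × ℝ => e (Y z.1 z.2) z.2) (univ ×ˢ Ici 0) :=
    h.contDiff_e.comp_contDiffOn (hY.prodMk contDiffOn_snd)
  have hnhds : ∀ ρ θ : ℝ, 0 < θ → univ ×ˢ Ici (0 : ℝ) ∈ 𝓝 (ρ, θ) := fun ρ θ hθ =>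
    prod_mem_nhds univ_mem (Ici_mem_nhds hθ)
  have hY0 : ∀ ρ, Y ρ 0 = ρ := fun ρ => by
    rw [← h.position_zero (Y ρ 0), hXY ρ 0 le_rfl]
  have hev : ∀ {θ : ℝ} (s : ℝ), 0 < θ →
      ∀ᶠ t in 𝓝 θ, Y (position E₀ e s t) t = s := fun {θ} s hθ => by
    filter_upwards [Ici_mem_nhds hθ] with t ht using hYX s t ht
  refine ⟨hP, hE, fun ρ => ?_, fun ρ => ?_, fun ρ θ hθ => ?_, fun ρ θ hθ => ?_⟩
  · simp only [hY0, h.initial_p]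
  · simp only [hY0, h.initial_e]
  · rw [interior_Ici, mem_Ioi] at hθ
    obtain ⟨s, rfl⟩ : ∃ s, position E₀ e s θ = ρ := ⟨_, hXY ρ θ hθ.le⟩
    have h1 := hasDerivAt_along_curve (f := fun ρ θ => p (Y ρ θ) θ)
      (x := fun t => position E₀ e s t)
      ((hP.contDiffAt (hnhds _ _ hθ)).differentiableAt two_ne_zero) (h.hasDerivAt_position s θ)
    have h2 : HasDerivAt (fun t => p (Y (position E₀ e s t) t) t) (-e s θ - ν * p s θ) θ :=
      (h.hasDerivAt_p s θ).congr_of_eventuallyEq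
        ((hev s hθ).mono fun t ht => by simp only [ht])
    have h3 := h1.unique h2
    rw [hYX s θ hθ.le]
    linarith
  · rw [interior_Ici, mem_Ioi] at hθ
    obtain ⟨s, rfl⟩ : ∃ s, position E₀ e s θ = ρ := ⟨_, hXY ρ θ hθ.le⟩
    have h1 := hasDerivAt_along_curve (f := fun ρ θ => e (Y ρ θ) θ)
      (x := fun t => position E₀ e s t)
      ((hE.contDiffAt (hnhds _ _ hθ)).differentiableAt two_ne_zero) (h.hasDerivAt_position s θ)
    have h2 : HasDerivAt (fun t => e (Y (position E₀ e s t) t) t) (velocity (p s θ)) θ :=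
      (h.hasDerivAt_e s θ).congr_of_eventuallyEq
        ((hev s hθ).mono fun t ht => by simp only [ht])
    have h3 := h1.unique h2
    rw [hYX s θ hθ.le]
    linarith

/-- The spatial derivatives of the solution in terms of the derivatives in Lagrangian
coordinates. -/
theorem deriv_mul_eq (h : IsLagrangianSolution ν P₀ E₀ p e) (hE₀ : ContDiff ℝ 2 E₀)
    (hYX : ∀ s θ, 0 ≤ θ → Y (position E₀ e s θ) θ = s)
    (hY : ContDiffOn ℝ 2 (fun z : ℝ × ℝ => Y z.1 z.2) (univ ×ˢ Ici 0)) {f : ℝ → ℝ → ℝ}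
    (hf : ContDiff ℝ 2 (fun z : ℝ × ℝ => f z.1 z.2)) (s : ℝ) {θ : ℝ} (hθ : 0 < θ) :
    deriv (fun r => f (Y r θ) θ) (position E₀ e s θ) *
      (density E₀ s + deriv (fun r => e r θ) s) = deriv (fun r => f r θ) s := by
  have hF : ContDiffOn ℝ 2 (fun z : ℝ × ℝ => f (Y z.1 z.2) z.2) (univ ×ˢ Ici 0) :=
    hf.comp_contDiffOn (hY.prodMk contDiffOn_snd)
  have hd := (hF.contDiffAt (x := (position E₀ e s θ, θ))
    (prod_mem_nhds univ_mem (Ici_mem_nhds hθ))).differentiableAt two_ne_zero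
  have h1 : HasDerivAt (fun r => f (Y r θ) θ) _ (position E₀ e s θ) :=
    (hasDerivAt_fst_slice (f := fun ρ θ => f (Y ρ θ) θ) hd).differentiableAt.hasDerivAt
  have h2 := h1.comp s (h.hasDerivAt_position_fst hE₀ s θ)
  have h3 : (fun r => f (Y r θ) θ) ∘ (fun r => position E₀ e r θ) = fun r => f r θ := by
    funext r
    simp only [Function.comp_apply, hYX r θ hθ.le]
  rw [h3] at h2
  exact h2.deriv.symm

/-- Every `C¹` solution is carried by the characteristics of the Lagrangian solution. -/
theorem eq_of_isClassicalSolution (h : IsLagrangianSolution ν P₀ E₀ p e) (hν : 0 ≤ ν)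
    {T : ℝ} {P E : ℝ → ℝ → ℝ} (hS : IsClassicalSolution 1 ν P₀ E₀ (Ico 0 T) P E) (s : ℝ) {θ : ℝ}
    (hθ : θ ∈ Ico 0 T) :
    P (position E₀ e s θ) θ = p s θ ∧ E (position E₀ e s θ) θ = e s θ := by
  set D : Set (ℝ × ℝ) := univ ×ˢ Ico 0 T with hD
  have hT : 0 < T := hθ.1.trans_lt hθ.2
  have huniq : UniqueDiffOn ℝ D := uniqueDiffOn_univ.prod (uniqueDiffOn_Ico 0 T)
  have hnhds : ∀ (r : ℝ) {t : ℝ}, t ∈ Ioo 0 θ → D ∈ 𝓝 (r, t) := fun r t ht =>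
    prod_mem_nhds univ_mem (Ico_mem_nhds ht.1 (ht.2.trans hθ.2))
  -- The comparison runs along the characteristic of the constructed solution, not of the given one.
  -- Only bounds on the given derivatives along this compact curve are needed, so no growth
  -- condition at infinity enters.
  set x : ℝ → ℝ := fun t => position E₀ e s t with hx
  have hxc : Continuous x := continuous_iff_continuousAt.2 fun t =>
    (h.hasDerivAt_position s t).continuousAt
  have hcurve : ContinuousOn (fun t => (x t, t)) (Icc 0 θ) := by fun_prop
  have hmaps : MapsTo (fun t => (x t, t)) (Icc 0 θ) D := fun t ht =>
    ⟨mem_univ _, ht.1, ht.2.trans_lt hθ.2⟩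
  have hbound : ∀ f : ℝ → ℝ → ℝ, ContDiffOn ℝ 1 (fun z : ℝ × ℝ => f z.1 z.2) D →
      ∃ C, ∀ t ∈ Ioo 0 θ, |deriv (fun r => f r t) (x t)| ≤ C := by
    intro f hf
    have hc := ((hf.continuousOn_fderivWithin huniq le_rfl).clm_apply
      (continuousOn_const (c := ((1, 0) : ℝ × ℝ)))).comp hcurve hmaps
    obtain ⟨C, hC⟩ := isCompact_Icc.exists_bound_of_continuousOn hc
    refine ⟨C, fun t ht => ?_⟩
    have h1 := hC t ⟨ht.1.le, ht.2.le⟩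
    have hd := (hf.contDiffAt (hnhds (x t) ht)).differentiableAt one_ne_zero
    rw [(hasDerivAt_fst_slice hd).deriv, ← fderivWithin_of_mem_nhds (hnhds (x t) ht)]
    exact h1
  obtain ⟨C₁, hC₁⟩ := hbound P hS.contDiffOn_P
  obtain ⟨C₂, hC₂⟩ := hbound E hS.contDiffOn_E
  set C := max 0 (max C₁ C₂) with hC
  have hC0 : 0 ≤ C := le_max_left _ _
  have hCP : ∀ t ∈ Ioo 0 θ, |deriv (fun r => P r t) (x t)| ≤ C := fun t ht =>
    (hC₁ t ht).trans ((le_max_left _ _).trans (le_max_right _ _))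
  have hCE : ∀ t ∈ Ioo 0 θ, |deriv (fun r => E r t) (x t)| ≤ C := fun t ht =>
    (hC₂ t ht).trans ((le_max_right _ _).trans (le_max_right _ _))
  set a : ℝ → ℝ := fun t => P (x t) t - p s t with ha
  set b : ℝ → ℝ := fun t => E (x t) t - e s t with hb
  have hac : ContinuousOn a (Icc 0 θ) :=
    (hS.contDiffOn_P.continuousOn.comp hcurve hmaps).sub
      fun t _ => (h.hasDerivAt_p s t).continuousAt.continuousWithinAt
  have hbc : ContinuousOn b (Icc 0 θ) :=
    (hS.contDiffOn_E.continuousOn.comp hcurve hmaps).sub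
      fun t _ => (h.hasDerivAt_e s t).continuousAt.continuousWithinAt
  have hint : ∀ t ∈ Ioo 0 θ, t ∈ interior (Ico 0 T) := fun t ht => by
    rw [interior_Ico]; exact ⟨ht.1, ht.2.trans hθ.2⟩
  have had : ∀ t ∈ Ioo 0 θ, HasDerivAt a
      (-(velocity (P (x t) t) - velocity (p s t)) * deriv (fun r => P r t) (x t) - b t
        - ν * a t) t := by
    intro t ht
    have h1 := (hasDerivAt_along_curve (x := x)
      ((hS.contDiffOn_P.contDiffAt (hnhds (x t) ht)).differentiableAt one_ne_zero)
      (h.hasDerivAt_position s t)).sub (h.hasDerivAt_p s t)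
    refine h1.congr_deriv ?_
    have h2 := hS.momentum_eq (x t) t (hint t ht)
    simp only [ha, hb]
    linear_combination h2
  have hbd : ∀ t ∈ Ioo 0 θ, HasDerivAt b
      ((velocity (P (x t) t) - velocity (p s t)) * (1 - deriv (fun r => E r t) (x t))) t := by
    intro t ht
    have h1 := (hasDerivAt_along_curve (x := x)
      ((hS.contDiffOn_E.contDiffAt (hnhds (x t) ht)).differentiableAt one_ne_zero)
      (h.hasDerivAt_position s t)).sub (h.hasDerivAt_e s t)
    refine h1.congr_deriv ?_
    have h2 := hS.field_eq (x t) t (hint t ht)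
    linear_combination h2
  -- A sufficient Grönwall constant: the cross terms contribute at most 2Ca² + (2 + C)(a² + b²), and
  -- the damping term has a good sign.
  set κ := 2 * (2 * C + 2) with hκ
  have hGd : ∀ t ∈ Ioo 0 θ, HasDerivAt (fun t => (a t ^ 2 + b t ^ 2) * Real.exp (-κ * t)) _ t :=
    fun t ht => (((had t ht).pow 2).add ((hbd t ht).pow 2)).mul
      ((hasDerivAt_id t).const_mul (-κ)).exp
  have hanti : AntitoneOn (fun t => (a t ^ 2 + b t ^ 2) * Real.exp (-κ * t)) (Icc 0 θ) := by
    refine antitoneOn_of_deriv_nonpos (convex_Icc 0 θ) (by fun_prop)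
      (fun t ht => ?_) fun t ht => ?_
    · rw [interior_Icc] at ht
      exact (hGd t ht).differentiableAt.differentiableWithinAt
    · rw [interior_Icc] at ht
      rw [(hGd t ht).deriv]
      set V := velocity (P (x t) t) - velocity (p s t)
      set Pr := deriv (fun r => P r t) (x t)
      set Er := deriv (fun r => E r t) (x t)
      have hV : |V| ≤ |a t| := abs_velocity_sub_le _ _
      have h1 : a t * (-V * Pr) ≤ C * a t ^ 2 := by
        calc a t * (-V * Pr) ≤ |a t * (-V * Pr)| := le_abs_self _
          _ = |a t| * (|V| * |Pr|) := by rw [abs_mul, abs_mul, abs_neg]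
          _ ≤ |a t| * (|a t| * C) := by gcongr; exact hCP t ht
          _ = C * a t ^ 2 := by rw [← sq_abs (a t)]; ring
      have h2 : b t * (V * (1 - Er)) ≤ (1 + C) * (|a t| * |b t|) := by
        have h3 : |1 - Er| ≤ 1 + C := by
          have := hCE t ht
          have h4 := abs_sub (1 : ℝ) Er
          rw [abs_one] at h4
          linarith
        calc b t * (V * (1 - Er)) ≤ |b t * (V * (1 - Er))| := le_abs_self _
          _ = |b t| * (|V| * |1 - Er|) := by rw [abs_mul, abs_mul]
          _ ≤ |b t| * (|a t| * (1 + C)) := by gcongr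
          _ = (1 + C) * (|a t| * |b t|) := by ring
      have h5 : -(a t * b t) ≤ |a t| * |b t| := by
        rw [← abs_mul]; exact neg_le_abs _
      have h6 : |a t| * |b t| ≤ (a t ^ 2 + b t ^ 2) / 2 := by
        nlinarith [sq_nonneg (|a t| - |b t|), sq_abs (a t), sq_abs (b t)]
      have h7 : (2 + C) * (|a t| * |b t|) ≤ (2 + C) * ((a t ^ 2 + b t ^ 2) / 2) := by gcongr
      have h8 : 0 ≤ ν * a t ^ 2 := by positivity
      have h9 : 2 * (a t * (-V * Pr - b t - ν * a t)) + 2 * (b t * (V * (1 - Er)))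
          - κ * (a t ^ 2 + b t ^ 2) ≤ 0 := by
        have : 0 ≤ C * b t ^ 2 := by positivity
        have : 0 ≤ C * a t ^ 2 := by positivity
        simp only [hκ]
        nlinarith [sq_nonneg (a t), sq_nonneg (b t)]
      have h10 := mul_nonpos_of_nonpos_of_nonneg h9 (Real.exp_pos (-κ * t)).le
      refine le_of_eq_of_le ?_ h10
      simp only [id, Pi.add_apply, Pi.pow_apply]
      push_cast
      ring
  have h0 := hanti ⟨le_rfl, hθ.1⟩ ⟨hθ.1, le_rfl⟩ hθ.1
  have ha0 : a 0 = 0 := by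
    simp only [ha, hx, hS.initial_P, h.initial_p, h.position_zero, sub_self]
  have hb0 : b 0 = 0 := by
    simp only [hb, hx, hS.initial_E, h.initial_e, h.position_zero, sub_self]
  simp only [ha0, hb0] at h0
  have h11 : a θ ^ 2 + b θ ^ 2 ≤ 0 := by
    nlinarith [Real.exp_pos (-κ * θ)]
  have haθ : a θ = 0 := by nlinarith [sq_nonneg (a θ), sq_nonneg (b θ)]
  have hbθ : b θ = 0 := by nlinarith [sq_nonneg (a θ), sq_nonneg (b θ)]
  exact ⟨sub_eq_zero.1 haθ, sub_eq_zero.1 hbθ⟩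

/-- The values decay at a uniform rate. The spatial derivatives are Lagrangian derivatives divided
by the Jacobian, and both the size of P₀', E₀' and the lower bound of N₀ are controlled only on
compact sets, hence local uniformity. -/
theorem stabilizes (h : IsLagrangianSolution ν P₀ E₀ p e) (hν : 2 ≤ ν)
    (hP₀ : ContDiff ℝ 2 P₀) (hE₀ : ContDiff ℝ 2 E₀) {R : ℝ} (hR : ∀ s, P₀ s ^ 2 + E₀ s ^ 2 ≤ R)
    (hN : ∀ s, 0 < density E₀ s) {C : ℝ} (hC : ∀ s θ, 0 ≤ θ → |e s θ - E₀ s| ≤ C)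
    (hXY : ∀ ρ θ, 0 ≤ θ → position E₀ e (Y ρ θ) θ = ρ)
    (hYX : ∀ s θ, 0 ≤ θ → Y (position E₀ e s θ) θ = s)
    (hY : ContDiffOn ℝ 2 (fun z : ℝ × ℝ => Y z.1 z.2) (univ ×ˢ Ici 0)) :
    Stabilizes (fun ρ θ => p (Y ρ θ) θ) (fun ρ θ => e (Y ρ θ) θ) := by
  obtain ⟨a, ha, hdec⟩ := h.exists_decay hν hR
  have hlim : ∀ B : ℝ, Tendsto (fun θ => B * Real.exp (-(a * θ))) atTop (𝓝 0) := by
    intro B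
    have := (Real.tendsto_exp_neg_atTop_nhds_zero.comp
      (tendsto_id.const_mul_atTop ha)).const_mul B
    simpa using this
  have huni : ∀ f : ℝ → ℝ → ℝ, (∀ s θ, f s θ ^ 2 ≤ p s θ ^ 2 + e s θ ^ 2) →
      TendstoUniformly (fun θ ρ => f (Y ρ θ) θ) (fun _ => 0) atTop := by
    intro f hf
    rw [Metric.tendstoUniformly_iff]
    intro ε hε
    filter_upwards [eventually_ge_atTop 0,
      (hlim (8 * R)).eventually_lt_const (show 0 < ε ^ 2 by positivity)] with θ hθ hlt ρ
    rw [dist_zero_left, Real.norm_eq_abs]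
    exact abs_lt_of_sq_lt_sq (((hf _ _).trans (hdec (Y ρ θ) θ hθ).1).trans_lt hlt) hε.le
  have hcdP : Continuous (deriv P₀) := hP₀.continuous_deriv (by norm_num)
  have hcdE : Continuous (deriv E₀) := hE₀.continuous_deriv (by norm_num)
  have hloc : ∀ f : ℝ → ℝ → ℝ, ContDiff ℝ 2 (fun z : ℝ × ℝ => f z.1 z.2) →
      (∀ s θ, deriv (fun r => f r θ) s ^ 2 ≤
        deriv (fun r => p r θ) s ^ 2 + deriv (fun r => e r θ) s ^ 2) →
      TendstoLocallyUniformly (fun θ ρ => deriv (fun r => f (Y r θ) θ) ρ) (fun _ => 0)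
        atTop := by
    intro f hfc hf
    rw [Metric.tendstoLocallyUniformly_iff]
    intro ε hε ρ₀
    -- Characteristics move by at most C, so all those meeting the unit ball around ρ₀ at any time
    -- start in this fixed interval.
    have hne : (Icc (ρ₀ - 1 - C) (ρ₀ + 1 + C)).Nonempty := by
      have := (abs_nonneg _).trans (hC 0 0 le_rfl)
      exact nonempty_Icc.2 (by linarith)
    obtain ⟨B, hB⟩ := isCompact_Icc.exists_bound_of_continuousOn
      (s := Icc (ρ₀ - 1 - C) (ρ₀ + 1 + C))
      (f := fun s => 8 * (deriv P₀ s ^ 2 + deriv E₀ s ^ 2)) (by fun_prop)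
    obtain ⟨s₀, -, hs₀⟩ := isCompact_Icc.exists_isMinOn hne
      (f := density E₀) (by unfold density; fun_prop)
    set n := density E₀ s₀ with hn
    have hn0 : 0 < n := hN s₀
    refine ⟨Metric.ball ρ₀ 1, Metric.ball_mem_nhds _ one_pos, ?_⟩
    -- The first smallness condition keeps the Jacobian above n/2; the second makes the numerator
    -- less than ε times that bound.
    filter_upwards [eventually_gt_atTop 0,
      (hlim B).eventually_lt_const (show 0 < (n / 2) ^ 2 by positivity),
      (hlim B).eventually_lt_const (show 0 < (ε * (n / 2)) ^ 2 by positivity)]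
      with θ hθ hlt1 hlt2 ρ hρ
    obtain ⟨s, rfl⟩ : ∃ s, position E₀ e s θ = ρ := ⟨_, hXY ρ θ hθ.le⟩
    have hs : s ∈ Icc (ρ₀ - 1 - C) (ρ₀ + 1 + C) := by
      have h1 := abs_le.1 (hC s θ hθ.le)
      rw [Metric.mem_ball, Real.dist_eq, abs_lt] at hρ
      simp only [position] at hρ
      constructor <;> linarith [h1.1, h1.2, hρ.1, hρ.2]
    have hd := (hdec s θ hθ.le).2
    have hBs : 8 * (deriv P₀ s ^ 2 + deriv E₀ s ^ 2) * Real.exp (-(a * θ)) ≤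
        B * Real.exp (-(a * θ)) :=
      mul_le_mul_of_nonneg_right ((le_abs_self _).trans (hB s hs)) (Real.exp_pos _).le
    have he : |deriv (fun r => e r θ) s| < n / 2 :=
      abs_lt_of_sq_lt_sq (by nlinarith [sq_nonneg (deriv (fun r => p r θ) s)]) (by positivity)
    have hf' : |deriv (fun r => f r θ) s| < ε * (n / 2) :=
      abs_lt_of_sq_lt_sq (by linarith [hf s θ]) (by positivity)
    have hx : n / 2 ≤ density E₀ s + deriv (fun r => e r θ) s := by
      have h1 : n ≤ density E₀ s := hs₀ hs
      linarith [(abs_lt.1 he).1]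
    have hmul := h.deriv_mul_eq hE₀ hYX hY hfc s hθ
    rw [dist_zero_left, Real.norm_eq_abs]
    rw [← hmul, abs_mul, abs_of_pos (by linarith : 0 < density E₀ s + deriv (fun r => e r θ) s)]
      at hf'
    have h2 := mul_le_mul_of_nonneg_left hx
      (abs_nonneg (deriv (fun r => f (Y r θ) θ) (position E₀ e s θ)))
    exact lt_of_mul_lt_mul_right (h2.trans_lt hf') (by positivity)
  exact ⟨huni p fun s θ => le_add_of_nonneg_right (sq_nonneg _),
    huni e fun s θ => le_add_of_nonneg_left (sq_nonneg _),
    hloc p h.contDiff_p fun s θ => le_add_of_nonneg_right (sq_nonneg _),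
    hloc e h.contDiff_e fun s θ => le_add_of_nonneg_left (sq_nonneg _)⟩

end IsLagrangianSolution

end ColdPlasma

/-! ### Choice of the collision coefficient and conclusion. -/

theorem proposition2p3 (P₀ E₀ : ℝ → ℝ)
    (hP₀ : ContDiff ℝ 2 P₀) (hE₀ : ContDiff ℝ 2 E₀)
    (hPb : ∃ M : ℝ, ∀ ρ, |P₀ ρ| ≤ M) (hEb : ∃ M : ℝ, ∀ ρ, |E₀ ρ| ≤ M)
    (hQb : ∃ b : ℝ, ∀ ρ, b ≤ deriv P₀ ρ)
    (hN : ∀ ρ, 0 < ColdPlasma.density E₀ ρ) :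
    ∃ ν : ℝ, 0 < ν ∧ ∃ P E : ℝ → ℝ → ℝ,
      ColdPlasma.IsClassicalSolution 2 ν P₀ E₀ (Set.Ici 0) P E ∧
      (∀ T : ℝ, 0 < T → ∀ P' E' : ℝ → ℝ → ℝ,
        ColdPlasma.IsClassicalSolution 1 ν P₀ E₀ (Set.Ico 0 T) P' E' →
        ∀ ρ : ℝ, ∀ θ ∈ Set.Ico 0 T, P' ρ θ = P ρ θ ∧ E' ρ θ = E ρ θ) ∧
      ColdPlasma.Stabilizes P E := by
  obtain ⟨M₁, hM₁⟩ := hPb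
  obtain ⟨M₂, hM₂⟩ := hEb
  obtain ⟨b, hb⟩ := hQb
  -- The coefficient will be ν = m + 1; taking m ≥ 1 serves the barrier argument and also gives ν ≥
  -- 2 for the decay estimate.
  obtain ⟨m, hm1, hmb⟩ : ∃ m : ℝ, 1 ≤ m ∧ -b ≤ m := ⟨max 1 (-b), le_max_left _ _, le_max_right _ _⟩
  have hν : 2 ≤ m + 1 := by linarith
  obtain ⟨p, e, h⟩ := ColdPlasma.exists_isLagrangianSolution (ν := m + 1) (by linarith) hP₀ hE₀
  have hR : ∀ s, P₀ s ^ 2 + E₀ s ^ 2 ≤ M₁ ^ 2 + M₂ ^ 2 := fun s =>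
    add_le_add (sq_le_sq.2 ((hM₁ s).trans (le_abs_self _)))
      (sq_le_sq.2 ((hM₂ s).trans (le_abs_self _)))
  obtain ⟨C, hC⟩ : ∃ C, ∀ s θ, 0 ≤ θ → |e s θ - E₀ s| ≤ C := by
    refine ⟨Real.sqrt (8 * (M₁ ^ 2 + M₂ ^ 2)) + M₂, fun s θ hθ => ?_⟩
    have h1 : |e s θ| ≤ Real.sqrt (8 * (M₁ ^ 2 + M₂ ^ 2)) :=
      Real.abs_le_sqrt (by nlinarith [h.sq_add_sq_le hν s hθ, hR s, sq_nonneg (p s θ)])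
    exact (abs_sub _ _).trans (add_le_add h1 (hM₂ s))
  have hpos : ∀ s θ, 0 ≤ θ → 0 < deriv (fun r => ColdPlasma.position E₀ e r θ) s := by
    intro s θ hθ
    rw [(h.hasDerivAt_position_fst hE₀ s θ).deriv]
    exact h.density_add_pos hm1 le_rfl (fun s => (neg_le.1 hmb).trans (hb s)) hN s θ hθ
  let Y : ℝ → ℝ → ℝ := fun ρ θ => Function.invFun (fun s => ColdPlasma.position E₀ e s θ) ρ
  have hXY : ∀ ρ θ, 0 ≤ θ → ColdPlasma.position E₀ e (Y ρ θ) θ = ρ := fun ρ θ hθ =>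
    Function.invFun_eq (h.surjective_position hE₀ (fun s => hC s θ hθ) ρ)
  have hYX : ∀ s θ, 0 ≤ θ → Y (ColdPlasma.position E₀ e s θ) θ = s := fun s θ hθ =>
    Function.leftInverse_invFun (strictMono_of_deriv_pos fun s => hpos s θ hθ).injective s
  have hY := ColdPlasma.contDiffOn_inverse_family (h.contDiff_position hE₀) hpos hXY hYX
  refine ⟨m + 1, by linarith, _, _, h.isClassicalSolution hXY hYX hY, ?_,
    h.stabilizes hν hP₀ hE₀ hR hN hC hXY hYX hY⟩
  intro T _ P' E' hS ρ θ hθ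
  have := h.eq_of_isClassicalSolution (by linarith) hS (Y ρ θ) hθ
  rwa [hXY ρ θ hθ.1] at this
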